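/- Let $\Omega$ be a (finite or infinite) set, whose subsets are called events, and let $P_0$ be a finitely additive probability on all events. Let $a,b\in\mathbb{R}$ with $b>0$, $a\le 0$, $0\le a+b\le 1$, put $c=1-(a+b)$, and let $(\underline P,\overline P)$ be the Vertical Barrier Model $$\underline P(E)=\max\{bP_0(E)+a,0\}\ (E\neq\Omega),\quad \underline P(\Omega)=1,\qquad \overline P(E)=\min\{bP_0(E)+c,1\}\ (E\neq\emptyset),\quad \overline P(\emptyset)=0.$$ For an event $B\neq\emptyset$, let $\underline E(\cdot\,|\,B)$ denote the natural extension of $\underline P$ to the conditional events $E|B$, that is, the restriction to these of the smallest Williams-coherent extension of $\underline P$ to the set $D_B=\{E|\Omega : E\subseteq\Omega\}\cup\{E|B : E\subseteq\Omega\}$ (an event $E$ is identified with $E|\Omega$), and let $\overline E(E|B)=1-\underline E(\neg E|B)$. Here a real function $Q$ on $D_B$ is Williams-coherent if for all $n\ge 0$, all $E_0|C_0,\dots,E_n|C_n\in D_B$ and all reals $s_0,\dots,s_n\ge 0$ such that $S=\bigcup\{C_i : s_i\neq 0\}$ is non-empty, $$\sup_{S}\Big(\sum_{i=1}^n s_i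 1_{C_i}\big(1_{E_i}-Q(E_i|C_i)\big)-s_0 1_{C_0}\big(1_{E_0}-Q(E_0|C_0)\big)\Big)\ge 0 .$$ A partition $\mathfrak B$ of $\Omega$ into non-empty events \emph{constricts} an event $A$ if $$\underline P(A)\le\underline E(A|B)\le\overline E(A|B)\le\overline P(A)\qquad\text{for all } B\in\mathfrak B,$$ and for at least one $B\in\mathfrak B$ at least one of the two outer inequalities is strict. Let $A$ be an event with $\underline P(A)<\overline P(A)$, and let $\mathfrak B$ be a (finite or infinite) partition of $\Omega$ into non-empty events such that $\underline P(B)>0$ for all $B\in\mathfrak B$. If there is $B^*\in\mathfrak B$ with $\underline P(A\wedge B^*)>0$ and $\underline P(\neg A\wedge B^*)>0$, then $\mathfrak B$ does not constrict $A$. -/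

import Mathlib

namespace ImpreciseProb

/-! The atoms of the underlying partition are the points of a type `Ω` (finite or infinite), and the
events that depend logically on it are all the subsets of `Ω`. -/

/-- A precise (de Finetti) probability on all events: a finitely additive probability. Countable
additivity is not required. -/
structure IsProbability {Ω : Type*} (P : Set Ω → ℝ) : Prop where
  nonneg : ∀ A, 0 ≤ P A
  univ : P Set.univ = 1
  union : ∀ A B, Disjoint A B → P (A ∪ B) = P A + P B

/-- `(lP, uP)` is a Vertical Barrier Model: for some probability `P₀` and reals `b > 0`, `a ≤ 0` with
`0 ≤ a + b ≤ 1`, and `c = 1 - (a + b)`, one has `lP A = max (b P₀(A) + a) 0` for `A ≠ Ω`, `lP Ω = 1`,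
`uP A = min (b P₀(A) + c) 1` for `A ≠ ∅`, `uP ∅ = 0`. -/
def IsVBM {Ω : Type*} (lP uP : Set Ω → ℝ) : Prop :=
  ∃ (P₀ : Set Ω → ℝ) (a b c : ℝ), IsProbability P₀ ∧
    0 < b ∧ a ≤ 0 ∧ 0 ≤ a + b ∧ a + b ≤ 1 ∧ c = 1 - (a + b) ∧
    (∀ A, A ≠ Set.univ → lP A = max (b * P₀ A + a) 0) ∧ lP Set.univ = 1 ∧
    (∀ A, A ≠ ∅ → uP A = min (b * P₀ A + c) 1) ∧ uP ∅ = 0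

/-- The gain at `ω` from a unit bet on the conditional event `A|B` at price `q`: it is
`1_B (1_A - q)`. -/
noncomputable def gain {Ω : Type*} (A B : Set Ω) (q : ℝ) (ω : Ω) : ℝ :=
  B.indicator (fun ω => A.indicator (fun _ => 1) ω - q) ω

/-- Williams coherence of a conditional lower probability `Q` (`Q A B` stands for the value at `A|B`)
on a set `D` of conditional events `(A, B)`: for all `A₀|B₀, A₁|B₁, …, Aₙ|Bₙ` in `D` and stakes
`s₀, …, sₙ ≥ 0`, if the union `S` of the `Bᵢ` with `sᵢ ≠ 0` is non-empty, then the supremum over `S`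
of `∑ sᵢ 1_{Bᵢ} (1_{Aᵢ} - Q(Aᵢ|Bᵢ)) - s₀ 1_{B₀} (1_{A₀} - Q(A₀|B₀))` is non-negative. This total gain
takes finitely many values, so that its supremum is attained. -/
def WCoherent {Ω : Type*} (D : Set (Set Ω × Set Ω)) (Q : Set Ω → Set Ω → ℝ) : Prop :=
  ∀ (n : ℕ) (A B : Fin n → Set Ω) (s : Fin n → ℝ) (A₀ B₀ : Set Ω) (s₀ : ℝ),
    (∀ i, (A i, B i) ∈ D) → (A₀, B₀) ∈ D → (∀ i, 0 ≤ s i) → 0 ≤ s₀ →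
    {ω | (s₀ ≠ 0 ∧ ω ∈ B₀) ∨ ∃ i, s i ≠ 0 ∧ ω ∈ B i}.Nonempty →
    ∃ ω ∈ {ω | (s₀ ≠ 0 ∧ ω ∈ B₀) ∨ ∃ i, s i ≠ 0 ∧ ω ∈ B i},
      0 ≤ ∑ i, s i * gain (A i) (B i) (Q (A i) (B i)) ω - s₀ * gain A₀ B₀ (Q A₀ B₀) ω

/-- All unconditional events (an event `A` is identified with `A|Ω`), together with all the
conditional events `A|B` for the given `B`. -/
def eventsGiven {Ω : Type*} (B : Set Ω) : Set (Set Ω × Set Ω) :=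
  {e | e.2 = Set.univ ∨ e.2 = B}

/-- `Q` is a Williams coherent extension of the unconditional lower probability `lP` to the events
conditional on `B`. -/
def IsCoherentExtension {Ω : Type*} (lP : Set Ω → ℝ) (B : Set Ω) (Q : Set Ω → Set Ω → ℝ) : Prop :=
  WCoherent (eventsGiven B) Q ∧ ∀ E, Q E Set.univ = lP E

/-- The natural extension of `lP` at `A|B`: the value at `A|B` of the least coherent extension, i.e.
the infimum of the values at `A|B` of all the coherent extensions (this pointwise infimum is itself
a coherent extension, see `isCoherentExtension_lowerExt`). -/
noncomputable def lowerExt {Ω : Type*} (lP : Set Ω → ℝ) (A B : Set Ω) : ℝ :=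
  sInf {x | ∃ Q, IsCoherentExtension lP B Q ∧ Q A B = x}

/-- As soon as a coherent extension exists, the pointwise infimum of the coherent extensions is a
coherent extension and lies below all of them; its value at `A|B` is `lowerExt lP A B`. -/
theorem isCoherentExtension_lowerExt {Ω : Type*} (lP : Set Ω → ℝ) (B : Set Ω) (hne : B.Nonempty)
    (h : ∃ Q, IsCoherentExtension lP B Q) :
    ∃ R, IsCoherentExtension lP B R ∧ (∀ A, R A B = lowerExt lP A B) ∧
      ∀ Q, IsCoherentExtension lP B Q → ∀ A, R A B ≤ Q A B := by
  obtain ⟨Q₁, hQ₁⟩ := h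
  have hbdd : ∀ A C, (A, C) ∈ eventsGiven B →
      ∀ Q, IsCoherentExtension lP B Q → 0 ≤ Q A C := by
    intro A C hC Q hQ
    have hCne : C.Nonempty := by
      rcases hC with hC | hC
      · obtain ⟨x, -⟩ := hne
        exact ⟨x, by simp_all⟩
      · simp_all
    obtain ⟨ω, hω, h0⟩ := hQ.1 0 Fin.elim0 Fin.elim0 Fin.elim0 A C 1 (fun i => i.elim0) hC
      (fun i => i.elim0) zero_le_one (by simpa using hCne)
    have hωC : ω ∈ C := by simpa using hω
    have hi : 0 ≤ A.indicator (fun _ => (1 : ℝ)) ω := Set.indicator_nonneg (by simp) ω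
    simp only [Finset.univ_eq_empty, Finset.sum_empty, gain, Set.indicator_of_mem hωC] at h0
    linarith
  set R : Set Ω → Set Ω → ℝ := fun A C => sInf {x | ∃ Q, IsCoherentExtension lP B Q ∧ Q A C = x}
    with hR
  have hle : ∀ A C, (A, C) ∈ eventsGiven B → ∀ Q, IsCoherentExtension lP B Q → R A C ≤ Q A C := by
    intro A C hC Q hQ
    refine csInf_le ⟨0, ?_⟩ ⟨Q, hQ, rfl⟩
    rintro x ⟨Q', hQ', rfl⟩
    exact hbdd A C hC Q' hQ'
  refine ⟨R, ⟨?_, ?_⟩, fun A => rfl, fun Q hQ A => hle A B (Or.inr rfl) Q hQ⟩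
  · intro n A C s A₀ C₀ s₀ hD hD₀ hs hs₀ hS
    by_contra! hcon
    set S := {ω | (s₀ ≠ 0 ∧ ω ∈ C₀) ∨ ∃ i, s i ≠ 0 ∧ ω ∈ C i} with hSdef
    set G : Ω → ℝ := fun ω => ∑ i, s i * gain (A i) (C i) (R (A i) (C i)) ω
      - s₀ * gain A₀ C₀ (R A₀ C₀) ω with hG
    -- the total gain takes finitely many values
    have hfg : ∀ (A C : Set Ω) (q : ℝ), (Set.range (gain A C q)).Finite := by
      intro A C q
      refine Set.Finite.subset (Set.toFinite {0, 1 - q, 0 - q}) ?_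
      rintro _ ⟨ω, rfl⟩
      by_cases h1 : ω ∈ C <;> by_cases h2 : ω ∈ A <;> simp [gain, h1, h2]
    have hfin : (Set.range G).Finite := by
      have h1 : (Set.range fun ω => ((fun i => gain (A i) (C i) (R (A i) (C i)) ω),
          gain A₀ C₀ (R A₀ C₀) ω)).Finite := by
        refine Set.Finite.subset
          ((Set.Finite.pi (fun i => hfg (A i) (C i) (R (A i) (C i)))).prod
            (hfg A₀ C₀ (R A₀ C₀))) ?_
        rintro _ ⟨ω, rfl⟩
        exact ⟨fun i _ => ⟨ω, rfl⟩, ⟨ω, rfl⟩⟩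
      refine (h1.image fun p => ∑ i, s i * p.1 i - s₀ * p.2).subset ?_
      rintro _ ⟨ω, rfl⟩
      exact ⟨_, ⟨ω, rfl⟩, rfl⟩
    obtain ⟨_, ⟨ω₁, hω₁, rfl⟩, hmax⟩ := Set.exists_max_image (G '' S) id
      (hfin.subset (Set.image_subset_range _ _)) (hS.image G)
    have hneg : G ω₁ < 0 := hcon ω₁ hω₁
    obtain ⟨δ, hδ, hδs⟩ : ∃ δ > 0, s₀ * δ < -G ω₁ := by
      refine ⟨-G ω₁ / (s₀ + 1), by apply div_pos <;> linarith, ?_⟩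
      rw [← mul_div_assoc, div_lt_iff₀ (by linarith)]
      nlinarith
    obtain ⟨_, ⟨Q, hQ, rfl⟩, hQδ⟩ := Real.lt_sInf_add_pos
      (s := {x | ∃ Q, IsCoherentExtension lP B Q ∧ Q A₀ C₀ = x}) ⟨_, Q₁, hQ₁, rfl⟩ hδ
    have hQδ' : Q A₀ C₀ < R A₀ C₀ + δ := hQδ
    obtain ⟨ω, hω, hge⟩ := hQ.1 n A C s A₀ C₀ s₀ hD hD₀ hs hs₀ hS
    have hm : G ω ≤ G ω₁ := hmax _ ⟨ω, hω, rfl⟩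
    have h1 : ∑ i, s i * gain (A i) (C i) (Q (A i) (C i)) ω ≤
        ∑ i, s i * gain (A i) (C i) (R (A i) (C i)) ω := by
      refine Finset.sum_le_sum fun i _ => mul_le_mul_of_nonneg_left ?_ (hs i)
      have := hle _ _ (hD i) Q hQ
      by_cases h1 : ω ∈ C i <;> simp [gain, h1] <;> linarith
    have h2 : gain A₀ C₀ (R A₀ C₀) ω ≤ gain A₀ C₀ (Q A₀ C₀) ω + δ := by
      by_cases h1 : ω ∈ C₀ <;> simp [gain, h1] <;> linarith
    have h3 := mul_le_mul_of_nonneg_left h2 hs₀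
    simp only [hG] at hm hδs
    linarith
  · intro E
    have : {x | ∃ Q, IsCoherentExtension lP B Q ∧ Q E Set.univ = x} = {lP E} := by
      ext x
      constructor
      · rintro ⟨Q, hQ, rfl⟩
        exact hQ.2 E
      · rintro rfl
        exact ⟨Q₁, hQ₁, hQ₁.2 E⟩
    simp [hR, this]

/-- The conjugate upper natural extension. -/
noncomputable def upperExt {Ω : Type*} (lP : Set Ω → ℝ) (A B : Set Ω) : ℝ :=
  1 - lowerExt lP Aᶜ B

/-- The partition `𝔅` constricts the event `A`, where `uP` is the conjugate of `lP`. -/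
def Constricts {Ω : Type*} (lP uP : Set Ω → ℝ) (𝔅 : Set (Set Ω)) (A : Set Ω) : Prop :=
  (∀ B ∈ 𝔅, lP A ≤ lowerExt lP A B ∧ lowerExt lP A B ≤ upperExt lP A B ∧
    upperExt lP A B ≤ uP A) ∧
  ∃ B ∈ 𝔅, lP A < lowerExt lP A B ∨ upperExt lP A B < uP A

end ImpreciseProb

/-! Write `B` for the cell with `lP (A ∩ B) > 0` and `lP (Aᶜ ∩ B) > 0`. The conditional envelope of
the probabilities dominating `lP` is a coherent extension, so the natural extension at `A|B` is at
most `P (A ∩ B) / P B` for each such `P` (`lowerExt_le_of_mem_credalSet`). A good `P` takes all the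
mass `-a` out of `A ∩ B` and puts a point mass `1 - (a + b)` in `B \ A`; this gives the bound `(b
P₀(A ∩ B) + a) / (b P₀(B) + 1 - b)` of `lowerExt_le_of_pos`. The same bound holds for `Aᶜ`, with the
same denominator.

If the partition constricted `A`, these bounds would dominate `b P₀(A) + a` and `b P₀(Aᶜ) + a`.
Adding the two inequalities gives `b (1 - b - 2a) (1 - P₀(B)) ≤ 0`. Since `lP A < uP A` forces `1 -
b - 2a > 0`, this means `P₀(B) = 1`. But then any other cell would have lower probability zero, so
the partition is `{Ω}`, where conditioning changes nothing and no inequality is strict. -/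

namespace ImpreciseProb

variable {Ω : Type*}

/-! ### Finitely additive probabilities and expected gains -/

namespace IsProbability

variable {P : Set Ω → ℝ}

theorem empty (hP : IsProbability P) : P ∅ = 0 := by
  have := hP.union ∅ ∅ (by simp)
  simp only [Set.union_self] at this
  linarith

theorem inter_add_inter_compl (hP : IsProbability P) (X F : Set Ω) :
    P (X ∩ F) + P (X ∩ Fᶜ) = P X := by
  rw [← hP.union _ _ (Set.disjoint_left.2 fun _ h h' => h'.2 h.2), Set.inter_union_compl]

theorem mono (hP : IsProbability P) {E F : Set Ω} (h : E ⊆ F) : P E ≤ P F := by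
  have h1 := hP.inter_add_inter_compl F E
  rw [Set.inter_eq_self_of_subset_right h] at h1
  linarith [hP.nonneg (F ∩ Eᶜ)]

theorem add_compl (hP : IsProbability P) (E : Set Ω) : P E + P Eᶜ = 1 := by
  have := hP.inter_add_inter_compl Set.univ E
  simpa [hP.univ] using this

/-- The expectation of a simple function that is non-positive on `X` is non-positive on `X`. -/
theorem sum_nonpos_on (hP : IsProbability P) {ι : Type*} (s : Finset ι) (F : ι → Set Ω)
    (t : ι → ℝ) : ∀ (X : Set Ω) (k : ℝ),
      (∀ ω ∈ X, k + ∑ j ∈ s, t j * (F j).indicator (fun _ => 1) ω ≤ 0) →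
        k * P X + ∑ j ∈ s, t j * P (X ∩ F j) ≤ 0 := by
  classical
  induction s using Finset.induction_on with
  | empty =>
    intro X k h
    rcases X.eq_empty_or_nonempty with rfl | ⟨ω, hω⟩
    · simp [hP.empty]
    · have := h ω hω
      simp only [Finset.sum_empty, add_zero] at this ⊢
      exact mul_nonpos_of_nonpos_of_nonneg this (hP.nonneg X)
  | insert i s hi ih =>
    intro X k h
    -- Split `X` along `F i`: on `F i` the coefficient `t i` joins the constant, off `F i` its term
    -- vanishes. No integral is needed.
    have h1 := ih (X ∩ F i) (k + t i) fun ω hω => by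
      have := h ω hω.1
      rw [Finset.sum_insert hi, Set.indicator_of_mem hω.2] at this
      linarith
    have h2 := ih (X ∩ (F i)ᶜ) k fun ω hω => by
      have := h ω hω.1
      rw [Finset.sum_insert hi, Set.indicator_of_notMem hω.2] at this
      linarith
    have h3 : ∑ j ∈ s, t j * P (X ∩ F j) =
        ∑ j ∈ s, t j * P (X ∩ F i ∩ F j) + ∑ j ∈ s, t j * P (X ∩ (F i)ᶜ ∩ F j) := by
      rw [← Finset.sum_add_distrib]
      refine Finset.sum_congr rfl fun j _ => ?_
      rw [← mul_add, Set.inter_right_comm X (F i), Set.inter_right_comm X (F i)ᶜ,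
        hP.inter_add_inter_compl]
    rw [Finset.sum_insert hi, h3, ← hP.inter_add_inter_compl X (F i)]
    linarith

theorem sum_nonpos (hP : IsProbability P) {ι : Type*} (s : Finset ι) (F : ι → Set Ω)
    (t : ι → ℝ) (h : ∀ ω, ∑ j ∈ s, t j * (F j).indicator (fun _ => 1) ω ≤ 0) :
    ∑ j ∈ s, t j * P (F j) ≤ 0 := by
  have := hP.sum_nonpos_on s F t Set.univ 0 (by simpa using h)
  simpa using this

end IsProbability

theorem gain_eq (A B : Set Ω) (q : ℝ) (ω : Ω) :
    gain A B q ω =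
      (A ∩ B).indicator (fun _ => 1) ω - q * B.indicator (fun _ => 1) ω := by
  by_cases h1 : ω ∈ B <;> by_cases h2 : ω ∈ A <;> simp [gain, h1, h2]

/-- If a combination of bets loses at least `ε` on `S` and is null elsewhere, then its expectation
under any probability `P` is at most `-ε P(S)`. -/
theorem IsProbability.sum_gain_le {P : Set Ω → ℝ} (hP : IsProbability P) {n : ℕ}
    (A B : Fin n → Set Ω) (s q : Fin n → ℝ) (A₀ B₀ S : Set Ω) (s₀ q₀ ε : ℝ)
    (h : ∀ ω, ∑ i, s i * gain (A i) (B i) (q i) ω - s₀ * gain A₀ B₀ q₀ ω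
      ≤ -ε * S.indicator (fun _ => 1) ω) :
    ∑ i, s i * (P (A i ∩ B i) - q i * P (B i)) - s₀ * (P (A₀ ∩ B₀) - q₀ * P B₀)
      ≤ -ε * P S := by
  -- Each gain is a combination of two indicators, so the hypothesis concerns one combination of `2n
  -- + 3` indicators, the last being that of `S`.
  have key := hP.sum_nonpos (Finset.univ : Finset ((Fin n ⊕ Fin n) ⊕ Fin 3))
    (Sum.elim (Sum.elim (fun i => A i ∩ B i) B) ![A₀ ∩ B₀, B₀, S])
    (Sum.elim (Sum.elim s (fun i => -(s i * q i))) ![-s₀, s₀ * q₀, ε]) (by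
      intro ω
      have h := h ω
      simp only [gain_eq, mul_sub, Finset.sum_sub_distrib] at h
      simp only [Fintype.sum_sum_type, Sum.elim_inl, Sum.elim_inr, Fin.sum_univ_three,
        Matrix.cons_val, neg_mul, Finset.sum_neg_distrib, mul_assoc]
      linarith)
  simp only [Fintype.sum_sum_type, Sum.elim_inl, Sum.elim_inr, Fin.sum_univ_three,
    Matrix.cons_val, neg_mul, Finset.sum_neg_distrib, mul_assoc] at key
  simp only [mul_sub, Finset.sum_sub_distrib]
  linarith

/-! ### Credal sets and the lower envelope theorem -/

/-- The probabilities that dominate `lP`. -/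
def credalSet (lP : Set Ω → ℝ) : Set (Set Ω → ℝ) :=
  {P | IsProbability P ∧ ∀ E, lP E ≤ P E}

/-- The lower envelope of the conditional probabilities of the members of the credal set. -/
noncomputable def condEnvelope (lP : Set Ω → ℝ) (A B : Set Ω) : ℝ :=
  sInf ((fun P : Set Ω → ℝ => P (A ∩ B) / P B) '' credalSet lP)

theorem condEnvelope_le {lP P : Set Ω → ℝ} (hP : P ∈ credalSet lP) (A B : Set Ω) :
    condEnvelope lP A B ≤ P (A ∩ B) / P B := by
  refine csInf_le ⟨0, ?_⟩ ⟨P, hP, rfl⟩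
  rintro _ ⟨P', hP', rfl⟩
  exact div_nonneg (hP'.1.nonneg _) (hP'.1.nonneg _)

theorem condEnvelope_univ {lP P : Set Ω → ℝ} (hP : P ∈ credalSet lP) {E : Set Ω}
    (hE : P E = lP E) : condEnvelope lP E Set.univ = lP E := by
  refine le_antisymm ?_ (le_csInf ⟨_, P, hP, rfl⟩ ?_)
  · simpa [hP.1.univ, hE] using condEnvelope_le hP E Set.univ
  · rintro _ ⟨P', hP', rfl⟩
    simpa [hP'.1.univ] using hP'.2 E

/-- The lower envelope theorem for `lP` and events conditional on an event of positive lower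
probability. -/
theorem isCoherentExtension_condEnvelope {lP : Set Ω → ℝ} {B : Set Ω} (hB : 0 < lP B)
    (henv : ∀ E, ∃ P ∈ credalSet lP, P E = lP E) :
    IsCoherentExtension lP B (condEnvelope lP) := by
  refine ⟨?_, fun E => ?_⟩
  swap
  · obtain ⟨P, hP, hE⟩ := henv E
    exact condEnvelope_univ hP hE
  have hle : ∀ P ∈ credalSet lP, ∀ A C, (A, C) ∈ eventsGiven B → lP B ≤ P C := by
    rintro P hP A C (hC | hC)
    · obtain rfl : C = Set.univ := hC
      exact (hP.2 B).trans (hP.1.mono (Set.subset_univ B))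
    · obtain rfl : C = B := hC
      exact hP.2 C
  intro n A C s A₀ C₀ s₀ hD hD₀ hs hs₀ hS
  by_contra! hcon
  set S := {ω | (s₀ ≠ 0 ∧ ω ∈ C₀) ∨ ∃ i, s i ≠ 0 ∧ ω ∈ C i} with hSdef
  set G : Ω → ℝ := fun ω => ∑ i, s i * gain (A i) (C i) (condEnvelope lP (A i) (C i)) ω
    - s₀ * gain A₀ C₀ (condEnvelope lP A₀ C₀) ω with hG
  have hfg : ∀ (A C : Set Ω) (q : ℝ), (Set.range (gain A C q)).Finite := by
    intro A C q
    refine Set.Finite.subset (Set.toFinite {0, 1 - q, 0 - q}) ?_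
    rintro _ ⟨ω, rfl⟩
    by_cases h1 : ω ∈ C <;> by_cases h2 : ω ∈ A <;> simp [gain, h1, h2]
  have hfin : (Set.range G).Finite := by
    have h1 := (Set.Finite.pi fun i => hfg (A i) (C i) (condEnvelope lP (A i) (C i))).prod
      (hfg A₀ C₀ (condEnvelope lP A₀ C₀))
    refine (h1.image fun p => ∑ i, s i * p.1 i - s₀ * p.2).subset ?_
    rintro _ ⟨ω, rfl⟩
    exact ⟨(fun i => gain (A i) (C i) (condEnvelope lP (A i) (C i)) ω,
      gain A₀ C₀ (condEnvelope lP A₀ C₀) ω), ⟨fun i _ => ⟨ω, rfl⟩, ⟨ω, rfl⟩⟩, rfl⟩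
  obtain ⟨_, ⟨ω₁, hω₁, rfl⟩, hmax⟩ := Set.exists_max_image (G '' S) id
    (hfin.subset (Set.image_subset_range _ _)) (hS.image G)
  have hneg : G ω₁ < 0 := hcon ω₁ hω₁
  -- Off `S` every bet with non-zero stake is called off; on `S` the loss is at least `-G ω₁`, the
  -- gain being greatest at `ω₁`.
  have hGS : ∀ ω, G ω ≤ -(-G ω₁) * S.indicator (fun _ => 1) ω := by
    intro ω
    by_cases hω : ω ∈ S
    · simpa [Set.indicator_of_mem hω] using hmax _ ⟨ω, hω, rfl⟩
    · have hω' := hω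
      simp only [hSdef, Set.mem_ofPred_eq, not_or, not_and, not_exists] at hω'
      have h1 : ∀ i, s i * gain (A i) (C i) (condEnvelope lP (A i) (C i)) ω = 0 := by
        intro i
        by_cases hi : s i = 0
        · simp [hi]
        · simp [gain, Set.indicator_of_notMem (hω'.2 i hi)]
      have h2 : s₀ * gain A₀ C₀ (condEnvelope lP A₀ C₀) ω = 0 := by
        by_cases hi : s₀ = 0
        · simp [hi]
        · simp [gain, Set.indicator_of_notMem (hω'.1 hi)]
      simp only [hG, h1, h2, Set.indicator_of_notMem hω, Finset.sum_const_zero, sub_zero,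
        mul_zero, le_refl]
  have hPS : ∀ P ∈ credalSet lP, lP B ≤ P S := by
    intro P hP
    obtain ⟨ω, ⟨h0, -⟩ | ⟨i, hi, -⟩⟩ := hS
    · exact (hle P hP _ _ hD₀).trans (hP.1.mono fun ω hω => Or.inl ⟨h0, hω⟩)
    · exact (hle P hP _ _ (hD i)).trans (hP.1.mono fun ω hω => Or.inr ⟨i, hi, hω⟩)
  have hε : 0 < -G ω₁ * lP B := mul_pos (neg_pos.2 hneg) hB
  -- The expected loss is at least `-G ω₁ * lP B` uniformly over the credal set, so `δ` can be fixed
  -- before choosing a `P` that attains the envelope at `A₀|C₀` up to `δ`. Under that `P` the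
  -- expected gain is at least `-s₀ * δ`, a contradiction.
  obtain ⟨δ, hδ, hδs⟩ : ∃ δ > 0, s₀ * δ < -G ω₁ * lP B := by
    refine ⟨-G ω₁ * lP B / (s₀ + 1), div_pos hε (by linarith), ?_⟩
    rw [← mul_div_assoc, div_lt_iff₀ (by linarith)]
    nlinarith
  obtain ⟨P₁, hP₁, -⟩ := henv ∅
  obtain ⟨_, ⟨P, hP, rfl⟩, hPδ⟩ := Real.lt_sInf_add_pos
    (s := (fun P : Set Ω → ℝ => P (A₀ ∩ C₀) / P C₀) '' credalSet lP) ⟨_, P₁, hP₁, rfl⟩ hδ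
  have hPδ' : P (A₀ ∩ C₀) / P C₀ < condEnvelope lP A₀ C₀ + δ := hPδ
  have hexp := hP.1.sum_gain_le A C s (fun i => condEnvelope lP (A i) (C i)) A₀ C₀ S s₀
    (condEnvelope lP A₀ C₀) (-G ω₁) hGS
  have hsum : 0 ≤ ∑ i, s i * (P (A i ∩ C i) - condEnvelope lP (A i) (C i) * P (C i)) := by
    refine Finset.sum_nonneg fun i _ => mul_nonneg (hs i) ?_
    have hpos := hB.trans_le (hle P hP _ _ (hD i))
    have := (le_div_iff₀ hpos).1 (condEnvelope_le hP (A i) (C i))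
    linarith
  have hC₀ := hB.trans_le (hle P hP _ _ hD₀)
  have h1 := (div_lt_iff₀ hC₀).1 hPδ'
  have hC₁ : P C₀ ≤ 1 := hP.1.univ ▸ hP.1.mono (Set.subset_univ _)
  have h2 : P (A₀ ∩ C₀) - condEnvelope lP A₀ C₀ * P C₀ ≤ δ := by nlinarith
  have h3 := mul_le_mul_of_nonneg_left h2 hs₀
  have h4 := mul_le_mul_of_nonneg_left (hPS P hP) (neg_pos.2 hneg).le
  linarith

/-- The conditional envelope is one coherent extension, and the natural extension is the least. Only
this inequality is needed, not equality with the envelope. -/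
theorem lowerExt_le_of_mem_credalSet {lP P : Set Ω → ℝ} {B : Set Ω} (hB : 0 < lP B)
    (hne : B.Nonempty) (henv : ∀ E, ∃ P ∈ credalSet lP, P E = lP E) (hP : P ∈ credalSet lP)
    (A : Set Ω) : lowerExt lP A B ≤ P (A ∩ B) / P B := by
  have hQ := isCoherentExtension_condEnvelope hB henv
  obtain ⟨R, -, hR, hmin⟩ := isCoherentExtension_lowerExt lP B hne ⟨_, hQ⟩
  exact (hR A ▸ hmin _ hQ A).trans (condEnvelope_le hP A B)

theorem lowerExt_univ [Nonempty Ω] {lP : Set Ω → ℝ} (h1 : 0 < lP Set.univ)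
    (henv : ∀ E, ∃ P ∈ credalSet lP, P E = lP E) (A : Set Ω) :
    lowerExt lP A Set.univ = lP A := by
  obtain ⟨R, hR, hRA, -⟩ := isCoherentExtension_lowerExt lP Set.univ Set.univ_nonempty
    ⟨_, isCoherentExtension_condEnvelope h1 henv⟩
  rw [← hRA, hR.2]

/-! ### Dominating probabilities of a Vertical Barrier Model -/

/-- The set function obtained from `b P₀` by scaling it by `u` on `E` and by `v` off `E`, and adding
a mass `m` at the point `x`. -/
noncomputable def perturb (P₀ : Set Ω → ℝ) (b u v m : ℝ) (E : Set Ω) (x : Ω) (X : Set Ω) : ℝ :=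
  b * (u * P₀ (X ∩ E) + v * P₀ (X ∩ Eᶜ)) + m * X.indicator (fun _ => 1) x

section Perturb

variable {P₀ lP : Set Ω → ℝ} {a b u v m : ℝ} {E : Set Ω} {x : Ω}

theorem isProbability_perturb (h₀ : IsProbability P₀) (hb : 0 ≤ b) (hu : 0 ≤ u) (hv : 0 ≤ v)
    (hm : 0 ≤ m) (htot : b * (u * P₀ E + v * P₀ Eᶜ) + m = 1) :
    IsProbability (perturb P₀ b u v m E x) where
  nonneg X := by
    have h1 := h₀.nonneg (X ∩ E)
    have h2 := h₀.nonneg (X ∩ Eᶜ)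
    have h3 : 0 ≤ X.indicator (fun _ => (1 : ℝ)) x := Set.indicator_nonneg (by simp) x
    unfold perturb
    positivity
  univ := by simpa [perturb] using htot
  union X Y h := by
    have hd : ∀ F, Disjoint (X ∩ F) (Y ∩ F) := fun F =>
      h.mono Set.inter_subset_left Set.inter_subset_left
    simp only [perturb, Set.union_inter_distrib_right, h₀.union _ _ (hd _),
      Set.indicator_union_of_disjoint h]
    ring

/-- The mass removed from any `X` is at most the total removed, hence at most `-a` by `hrem`, and
the point mass only helps. -/
theorem perturb_mem_credalSet (h₀ : IsProbability P₀) (hb : 0 ≤ b)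
    (hlP : ∀ A, A ≠ Set.univ → lP A = max (b * P₀ A + a) 0) (hlP1 : lP Set.univ = 1)
    (hu : 0 ≤ u) (hu1 : u ≤ 1) (hv : 0 ≤ v) (hv1 : v ≤ 1) (hm : 0 ≤ m)
    (htot : b * (u * P₀ E + v * P₀ Eᶜ) + m = 1)
    (hrem : b * ((1 - u) * P₀ E + (1 - v) * P₀ Eᶜ) ≤ -a) :
    perturb P₀ b u v m E x ∈ credalSet lP := by
  have hP : IsProbability (perturb P₀ b u v m E x) :=
    isProbability_perturb h₀ hb hu hv hm htot
  refine ⟨hP, fun X => ?_⟩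
  by_cases hX : X = Set.univ
  · rw [hX, hP.univ, hlP1]
  rw [hlP X hX]
  refine max_le ?_ (hP.nonneg X)
  have h1 := mul_le_mul_of_nonneg_left (h₀.mono (Set.inter_subset_right : X ∩ E ⊆ E))
    (sub_nonneg.2 hu1)
  have h2 := mul_le_mul_of_nonneg_left (h₀.mono (Set.inter_subset_right : X ∩ Eᶜ ⊆ Eᶜ))
    (sub_nonneg.2 hv1)
  have h3 := mul_le_mul_of_nonneg_left (add_le_add h1 h2) hb
  have h4 : 0 ≤ m * X.indicator (fun _ => (1 : ℝ)) x :=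
    mul_nonneg hm (Set.indicator_nonneg (by simp) x)
  rw [← h₀.inter_add_inter_compl X E]
  unfold perturb
  linarith

/-- A dominating probability that removes all the mass `-a` from `E` and puts the mass
`1 - (a + b)` at a point outside `E`. -/
theorem exists_mem_credalSet_of_pos (h₀ : IsProbability P₀) (hb : 0 < b) (ha : a ≤ 0)
    (hab : a + b ≤ 1) (hlP : ∀ A, A ≠ Set.univ → lP A = max (b * P₀ A + a) 0)
    (hlP1 : lP Set.univ = 1) (hE : 0 < b * P₀ E + a) (hx : x ∉ E) :
    ∃ P ∈ credalSet lP, P E = b * P₀ E + a ∧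
      ∀ F, Disjoint F E → x ∈ F → P F = b * P₀ F + (1 - (a + b)) := by
  have hp : 0 < b * P₀ E := by linarith
  have hp' : P₀ E ≠ 0 := fun h => by simp [h] at hp
  have hueq : b * ((1 + a / (b * P₀ E)) * P₀ E) = b * P₀ E + a := by field_simp
  have hc := h₀.add_compl E
  have hbc : b * P₀ Eᶜ = b - b * P₀ E := by rw [eq_sub_iff_add_eq'.2 hc]; ring
  refine ⟨perturb P₀ b (1 + a / (b * P₀ E)) 1 (1 - (a + b)) E x,
    perturb_mem_credalSet h₀ hb.le hlP hlP1 ?_ ?_ zero_le_one le_rfl (by linarith) ?_ ?_, ?_, ?_⟩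
  · rw [show 1 + a / (b * P₀ E) = (b * P₀ E + a) / (b * P₀ E) by field_simp]
    positivity
  · linarith [div_nonpos_of_nonpos_of_nonneg ha hp.le]
  · rw [mul_add, hueq]; linarith
  · rw [sub_self, zero_mul, add_zero, sub_mul, mul_sub, hueq]; linarith
  · rw [perturb, Set.inter_self, Set.inter_compl_self, h₀.empty, Set.indicator_of_notMem hx,
      mul_add, hueq]
    ring
  · intro F hF hxF
    rw [perturb, hF.inter_eq, Set.inter_eq_self_of_subset_left hF.subset_compl_right, h₀.empty,
      Set.indicator_of_mem hxF]
    ring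

/-- A dominating probability that vanishes on `E`. -/
theorem exists_mem_credalSet_of_nonpos (h₀ : IsProbability P₀) (hb : 0 < b)
    (hab : a + b ≤ 1) (hlP : ∀ A, A ≠ Set.univ → lP A = max (b * P₀ A + a) 0)
    (hlP1 : lP Set.univ = 1) (hE : b * P₀ E + a ≤ 0) (hx : x ∉ E) :
    ∃ P ∈ credalSet lP, P E = 0 := by
  have hc := h₀.add_compl E
  have hbc : b * P₀ Eᶜ = b - b * P₀ E := by rw [eq_sub_iff_add_eq'.2 hc]; ring
  have hval : ∀ v m, perturb P₀ b 0 v m E x E = 0 := by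
    intro v m
    rw [perturb, Set.inter_self, Set.inter_compl_self, h₀.empty, Set.indicator_of_notMem hx]
    ring
  -- All of `E` is emptied. If `Eᶜ` carries mass at most 1, the point `x` receives the deficit;
  -- otherwise `Eᶜ` is scaled down to mass 1, and the total removed is `b - 1 ≤ -a`.
  rcases le_total (b * P₀ Eᶜ) 1 with h | h
  · refine ⟨perturb P₀ b 0 1 (1 - b * P₀ Eᶜ) E x, perturb_mem_credalSet h₀ hb.le hlP hlP1 le_rfl
      zero_le_one zero_le_one le_rfl (by linarith) (by ring) (by linarith), hval _ _⟩
  · have hne : P₀ Eᶜ ≠ 0 := fun h' => by simp [h'] at h; linarith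
    have hveq : b * (1 / (b * P₀ Eᶜ) * P₀ Eᶜ) = 1 := by field_simp
    refine ⟨perturb P₀ b 0 (1 / (b * P₀ Eᶜ)) 0 E x, perturb_mem_credalSet h₀ hb.le hlP hlP1 le_rfl
      zero_le_one (by positivity) ?_ le_rfl ?_ ?_, hval _ _⟩
    · rw [div_le_one (by linarith)]; exact h
    · rw [zero_mul, zero_add, hveq, add_zero]
    · rw [mul_add, sub_mul _ _ (P₀ Eᶜ), mul_sub _ _ (1 / (b * P₀ Eᶜ) * P₀ Eᶜ), hveq]; linarith

/-- The lower probability of a Vertical Barrier Model is the lower envelope of its credal set. -/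
theorem exists_mem_credalSet_eq [Nonempty Ω] (h₀ : IsProbability P₀) (hb : 0 < b) (ha : a ≤ 0)
    (hab : a + b ≤ 1)
    (hlP : ∀ A, A ≠ Set.univ → lP A = max (b * P₀ A + a) 0) (hlP1 : lP Set.univ = 1)
    (E : Set Ω) : ∃ P ∈ credalSet lP, P E = lP E := by
  by_cases hE : E = Set.univ
  · obtain ⟨x⟩ := ‹Nonempty Ω›
    obtain ⟨P, hP, -⟩ := exists_mem_credalSet_of_nonpos (E := ∅) h₀ hb hab hlP hlP1
      (by simpa [h₀.empty] using ha) (Set.notMem_empty x)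
    exact ⟨P, hP, by rw [hE, hP.1.univ, hlP1]⟩
  obtain ⟨x, hx⟩ := (Set.ne_univ_iff_exists_notMem E).1 hE
  rw [hlP E hE]
  rcases lt_or_ge 0 (b * P₀ E + a) with h | h
  · obtain ⟨P, hP, hPE, -⟩ := exists_mem_credalSet_of_pos h₀ hb ha hab hlP hlP1 h hx
    exact ⟨P, hP, by rw [hPE, max_eq_left h.le]⟩
  · obtain ⟨P, hP, hPE⟩ := exists_mem_credalSet_of_nonpos h₀ hb hab hlP hlP1 h hx
    exact ⟨P, hP, by rw [hPE, max_eq_right h]⟩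

/-- The upper bound of the natural extension at `A|B` when `A ∩ B` has positive lower probability
and does not exhaust `B`. -/
theorem lowerExt_le_of_pos (h₀ : IsProbability P₀) (hb : 0 < b) (ha : a ≤ 0)
    (hab : a + b ≤ 1)
    (hlP : ∀ A, A ≠ Set.univ → lP A = max (b * P₀ A + a) 0) (hlP1 : lP Set.univ = 1)
    {A B : Set Ω} (hB : 0 < lP B) (hpos : 0 < b * P₀ (A ∩ B) + a) (hne : (Aᶜ ∩ B).Nonempty) :
    0 < b * P₀ B + 1 - b ∧
      lowerExt lP A B ≤ (b * P₀ (A ∩ B) + a) / (b * P₀ B + 1 - b) := by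
  obtain ⟨x, hxA, hxB⟩ := hne
  have : Nonempty Ω := ⟨x⟩
  obtain ⟨P, hP, h1, h2⟩ := exists_mem_credalSet_of_pos (x := x) h₀ hb ha hab hlP hlP1 hpos
    (fun h => hxA h.1)
  -- The point mass lies in `B \ A`: it enlarges `P B` without enlarging `P (A ∩ B)`.
  have h3 := h2 (B ∩ Aᶜ) (Set.disjoint_left.2 fun _ h h' => h.2 h'.1) ⟨hxB, hxA⟩
  have h4 := hP.1.inter_add_inter_compl B A
  have h5 := h₀.inter_add_inter_compl B A
  rw [Set.inter_comm B A] at h4 h5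
  have hPB : P B = b * P₀ B + 1 - b := by rw [← h4, h1, h3, ← h5]; ring
  rw [← hPB, ← h1]
  exact ⟨hB.trans_le (hP.2 B), lowerExt_le_of_mem_credalSet hB ⟨x, hxB⟩
    (exists_mem_credalSet_eq h₀ hb ha hab hlP hlP1) hP A⟩

end Perturb

end ImpreciseProb

/-! ### The main theorem -/

open ImpreciseProb in
theorem proposition11 {Ω : Type*} (lP uP : Set Ω → ℝ) (hVBM : ImpreciseProb.IsVBM lP uP)
    (A : Set Ω) (𝔅 : Set (Set Ω)) (h𝔅 : Setoid.IsPartition 𝔅)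
    (hpos : ∀ B ∈ 𝔅, 0 < lP B)
    (hA : lP A < uP A)
    (hB : ∃ B ∈ 𝔅, 0 < lP (A ∩ B) ∧ 0 < lP (Aᶜ ∩ B)) :
    ¬ ImpreciseProb.Constricts lP uP 𝔅 A := by
  obtain ⟨P₀, a, b, c, h₀, hb, ha, -, hab, rfl, hlP, hlP1, huP, -⟩ := hVBM
  obtain ⟨B, hB𝔅, hAB, hAcB⟩ := hB
  rintro ⟨hall, B', hB'𝔅, hstrict⟩
  have hBne : B.Nonempty := Setoid.nonempty_of_mem_partition h𝔅 hB𝔅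
  have : Nonempty Ω := ⟨hBne.some⟩
  have hempty : lP ∅ = 0 := by
    rw [hlP ∅ Set.empty_ne_univ, h₀.empty, mul_zero, zero_add, max_eq_right ha]
  have hne1 : (A ∩ B).Nonempty := by
    rw [Set.nonempty_iff_ne_empty]; rintro h; rw [h, hempty] at hAB; exact hAB.false
  have hne2 : (Aᶜ ∩ B).Nonempty := by
    rw [Set.nonempty_iff_ne_empty]; rintro h; rw [h, hempty] at hAcB; exact hAcB.false
  obtain ⟨y, hyA, hyB⟩ := hne1
  obtain ⟨z, hzA, hzB⟩ := hne2
  have hAuniv : A ≠ Set.univ := fun h => hzA (h ▸ Set.mem_univ z)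
  have hAcuniv : Aᶜ ≠ Set.univ := fun h => (h ▸ Set.mem_univ y : y ∈ Aᶜ) hyA
  have hconj : uP A = 1 - lP Aᶜ := by
    rw [huP A (Set.nonempty_iff_ne_empty.1 ⟨y, hyA⟩), hlP _ hAcuniv,
      eq_sub_iff_add_eq'.2 (h₀.add_compl A), ← min_sub_sub_left]
    ring_nf
  by_cases hP₀B : P₀ B = 1
  -- Any other cell would be `P₀`-null, hence of lower probability `max a 0 = 0`.
  · have huniv : ∀ C ∈ 𝔅, C = B := by
      intro C hC
      by_contra hCB
      have hd : Disjoint C B := h𝔅.pairwiseDisjoint hC hB𝔅 hCB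
      have hCu : C ≠ Set.univ := by
        rintro rfl
        exact hBne.ne_empty (by simpa using hd)
      have h1 := h₀.mono (hd.subset_compl_right)
      have h2 := h₀.add_compl B
      have h3 : P₀ C = 0 := le_antisymm (by linarith) (h₀.nonneg C)
      have h4 := hpos C hC
      rw [hlP C hCu, h3, mul_zero, zero_add, max_eq_right ha] at h4
      exact h4.false
    have hBu : B = Set.univ := by
      rw [← h𝔅.sUnion_eq_univ]
      exact Set.Subset.antisymm (Set.subset_sUnion_of_mem hB𝔅)
        (Set.sUnion_subset fun C hC => (huniv C hC).subset)
    have hext := lowerExt_univ (hlP1 ▸ zero_lt_one)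
      (exists_mem_credalSet_eq h₀ hb ha hab hlP hlP1)
    rw [huniv B' hB'𝔅, hBu, upperExt, hext, hext, hconj] at hstrict
    simp at hstrict
  · have hlt : P₀ B < 1 := lt_of_le_of_ne (h₀.univ ▸ h₀.mono (Set.subset_univ B)) hP₀B
    have hAB' : 0 < b * P₀ (A ∩ B) + a := by
      rw [hlP (A ∩ B) fun h => hzA (h.symm.subset (Set.mem_univ z)).1] at hAB
      simpa using hAB
    have hAcB' : 0 < b * P₀ (Aᶜ ∩ B) + a := by
      rw [hlP (Aᶜ ∩ B) fun h => (h.symm.subset (Set.mem_univ y)).1 hyA] at hAcB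
      simpa using hAcB
    obtain ⟨hd, hl⟩ := lowerExt_le_of_pos h₀ hb ha hab hlP hlP1 (hpos B hB𝔅) hAB'
      ⟨z, hzA, hzB⟩
    obtain ⟨-, hu⟩ := lowerExt_le_of_pos h₀ hb ha hab hlP hlP1 (hpos B hB𝔅) hAcB'
      ⟨y, by simpa using hyA, hyB⟩
    obtain ⟨h1, -, h2⟩ := hall B hB𝔅
    -- By conjugacy the upper inequality becomes `lP Aᶜ ≤ lowerExt lP Aᶜ B`, so `A` and `Aᶜ` play
    -- symmetric roles.
    rw [upperExt, hconj] at h2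
    have h3 : b * P₀ A + a ≤ lP A := hlP A hAuniv ▸ le_max_left _ _
    have h4 : b * P₀ Aᶜ + a ≤ lP Aᶜ := hlP _ hAcuniv ▸ le_max_left _ _
    have h5 := h₀.add_compl A
    have h6 := h₀.inter_add_inter_compl B A
    rw [Set.inter_comm B A, Set.inter_comm B Aᶜ] at h6
    have h7 := (le_div_iff₀ hd).1 ((h3.trans h1).trans hl)
    have h8 := (le_div_iff₀ hd).1 (h4.trans ((by linarith : lP Aᶜ ≤ lowerExt lP Aᶜ B).trans hu))
    have h9 : (b + 2 * a) * (b * P₀ B + 1 - b) ≤ b * P₀ B + 2 * a := by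
      calc _ = (b * P₀ A + a) * (b * P₀ B + 1 - b) + (b * P₀ Aᶜ + a) * (b * P₀ B + 1 - b) := by
            rw [eq_sub_iff_add_eq'.2 h5]; ring
        _ ≤ _ := add_le_add h7 h8
        _ = _ := by rw [← h6]; ring
    -- From `hA` and conjugacy, `lP A + lP Aᶜ < 1`, while this sum is at least `b + 2 * a`.
    have hk : 0 < 1 - b - 2 * a := by
      have : b * P₀ A + b * P₀ Aᶜ = b := by rw [← mul_add, h5, mul_one]
      linarith
    -- Rearranged, `h9` says that `(1 - b - 2 * a) * (b * (1 - P₀ B)) ≤ 0`.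
    nlinarith [mul_pos hk (mul_pos hb (sub_pos.2 hlt))]
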